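/- **Model.** For a multigraph, a loop contributes $2$ to the degree of its vertex. The random multigraph $G_1^t$ with vertices $v_1,\dots,v_t$ and $t$ edges is built as follows. $G_1^1$ consists of $v_1$ with one loop. Given $G_1^{t-1}$, the graph $G_1^t$ is obtained by adding a vertex $v_t$ and a single edge from $v_t$ to $v_i$, where $i\in\{1,\dots,t\}$ is random with $$\Pr[i=s]=\begin{cases}\dfrac{d_{G_1^{t-1}}(v_s)}{2t-1}, & 1\le s\le t-1,\\[2mm] \dfrac{1}{2t-1}, & s=t.\end{cases}$$ For $m\ge 1$, the preferential attachment graph $G_m^n$ is the random multigraph with $n$ vertices and $mn$ edges obtained from $G_1^{mn}$ by merging, for each $i=1,\dots,n$, the $m$ consecutive vertices $v_{(i-1)m+1},\dots,v_{im}$ into a single vertex (loops and parallel edges are kept). **Shallow topological minors.** A simple graph $M$ with $V(M)\subseteq V(G)$ is an *$r$-shallow topological minor* of a graph $G$ if each edge $uv$ of $M$ can be assigned a path in $G$ from $u$ to $v$ of length at most $2r+1$ such that no path has a vertex of $M$ in its interior and paths assigned to different edges share no interior vertices. (Loops and multiplicities of edges of $G$ play no role.) Let $G\mathop{\widetilde\triangledown}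 r$ be the set of all $r$-shallow topological minors of $G$ and $$\omega(G\mathop{\widetilde\triangledown} r)=\max_{H\in G\mathop{\widetilde\triangledown} r}\omega(H),$$ where $\omega(H)$ is the clique number of $H$. A random graph model, i.e. a sequence of probability distributions of random graphs $G_n$ with $n$ vertices, is *asymptotically almost surely somewhere-dense* if for every function $f:\mathbb N\to\mathbb R$ there is an $r\in\mathbb N$ such that $\lim_{n\to\infty}\Pr[\omega(G_n\mathop{\widetilde\triangledown} r)>f(r)]=1$. **Corollary.** For every $m\ge 2$, the preferential attachment model $(G_m^n)_{n}$ is asymptotically almost surely somewhere-dense: for every $f:\mathbb N\to\mathbb R$ there is an $r\in\mathbb N$ such that $$\lim_{n\to\infty}\Pr\bigl[\omega(G_m^n\mathop{\widetilde\triangledown} r)>f(r)\bigr]=1 .$$ -/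

import Mathlib

open scoped ENNReal

/-- A finite undirected multigraph on the vertex set `V`, given by its multiset of edges.
Loops `s(v, v)` and parallel edges are allowed. -/
abbrev Multigraph (V : Type) : Type := Multiset (Sym2 V)

namespace Multigraph

/-- The degree of `v`: the number of edge endpoints equal to `v`, so that a loop counts twice. -/
def degree {V : Type} [DecidableEq V] (E : Multigraph V) (v : V) : ℕ :=
  (E.bind Sym2.toMultiset).count v

/-- The simple graph obtained by forgetting loops and multiplicities. -/
def toSimple {V : Type} (E : Multigraph V) : SimpleGraph V :=
  SimpleGraph.fromEdgeSet {e | e ∈ E}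

/-- The multigraph obtained by merging vertices along `p`. Every edge is kept, and edges between
vertices that are merged together become loops. -/
def merge {V W : Type} (p : V → W) (E : Multigraph V) : Multigraph W :=
  E.map (Sym2.map p)

theorem sum_degree {V : Type} [DecidableEq V] [Fintype V] (E : Multigraph V) :
    ∑ v, E.degree v = 2 * E.card := by
  unfold degree
  rw [Multiset.sum_count_eq_card (fun a _ => Finset.mem_univ a), Multiset.card_bind]
  have h : E.map (Multiset.card ∘ Sym2.toMultiset) = E.map (fun _ => 2) :=
    Multiset.map_congr rfl (fun z _ => Sym2.card_toMultiset z)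
  rw [h]
  simp [mul_comm]

end Multigraph

/-- A random graph model: for every `n` a probability distribution on graphs with `n` vertices. -/
abbrev RandomGraphModel : Type := ∀ n : ℕ, PMF (Multigraph (Fin n))

namespace PreferentialAttachment

/-- Multigraphs with `t` vertices and `t` edges, the states of the process with `m = 1`. -/
abbrev State (t : ℕ) : Type := {E : Multigraph (Fin t) // E.card = t}

/-- The probability that the edge of the new vertex `Fin.last t` (the `(t + 1)`-st one) leads to
vertex `i`: it is `d(i) / (2 (t + 1) - 1)` for an old vertex `i` and `1 / (2 (t + 1) - 1)` for the
new vertex itself. -/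
noncomputable def attachProb {t : ℕ} (E : State t) (i : Fin (t + 1)) : ℝ≥0∞ :=
  Fin.lastCases (motive := fun _ => ℝ≥0∞) (1 / (2 * (t : ℝ≥0∞) + 1))
    (fun s => (E.1.degree s : ℝ≥0∞) / (2 * (t : ℝ≥0∞) + 1)) i

theorem sum_attachProb {t : ℕ} (E : State t) : ∑ i, attachProb E i = 1 := by
  rw [Fin.sum_univ_castSucc]
  simp only [attachProb, Fin.lastCases_castSucc, Fin.lastCases_last, div_eq_mul_inv]
  rw [← Finset.sum_mul, ← add_mul, ← Nat.cast_sum, Multigraph.sum_degree, E.2]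
  push_cast
  refine ENNReal.mul_inv_cancel (by simp) ?_
  exact_mod_cast ENNReal.natCast_ne_top (2 * t + 1)

/-- Add the new vertex `Fin.last t` together with a single edge from it to `i`. -/
def addVertex {t : ℕ} (E : State t) (i : Fin (t + 1)) : State (t + 1) :=
  ⟨s(Fin.last t, i) ::ₘ E.1.merge Fin.castSucc, by simp [Multigraph.merge, E.2]⟩

/-- The law of `G_1^t`. The process is started from the graph without vertices; its first step is
deterministic and yields `G_1^1`, a single vertex with one loop. -/
noncomputable def process : ∀ t : ℕ, PMF (State t)
  | 0 => PMF.pure ⟨0, rfl⟩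
  | t + 1 => (process t).bind fun E =>
      (PMF.ofFintype (attachProb E) (sum_attachProb E)).map (addVertex E)

/-- The law of `G_m^n`: in `G_1^{mn}` each block of `m` consecutive vertices is merged into one
vertex (vertices are numbered from `0`, and `Fin.divNat` sends `j` to `⌊j / m⌋`). -/
noncomputable def model (m : ℕ) : RandomGraphModel := fun n =>
  (process (n * m)).map fun E => E.1.merge (Fin.divNat (m := n) (n := m))

end PreferentialAttachment

/-- `M`, a graph on a set `W` of vertices of `G` (the principal vertices), is an `r`-shallow
topological minor of `G`: the edges of `M` can be replaced by paths of `G` of length at most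
`2 r + 1` with the same ends, no path has a principal vertex in its interior, and paths that belong
to different edges of `M` share no vertices except principal ones. -/
def IsShallowTopologicalMinor {V : Type} (G : SimpleGraph V) (r : ℕ) {W : Set V}
    (M : SimpleGraph W) : Prop :=
  ∃ P : ∀ u v : W, M.Adj u v → G.Walk (u : V) (v : V),
    (∀ (u v : W) (h : M.Adj u v), (P u v h).IsPath ∧ (P u v h).length ≤ 2 * r + 1) ∧
    (∀ (u v : W) (h : M.Adj u v), P v u h.symm = (P u v h).reverse) ∧
    (∀ (u v : W) (h : M.Adj u v), ∀ x ∈ (P u v h).support, x ∈ W → x = u ∨ x = v) ∧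
    (∀ (u v : W) (h : M.Adj u v) (u' v' : W) (h' : M.Adj u' v'), s(u, v) ≠ s(u', v') →
      ∀ x ∈ (P u v h).support, x ∈ (P u' v' h').support → x ∈ W)

/-- The set of all `r`-shallow topological minors of `G`. -/
def shallowTopologicalMinors {V : Type} (G : SimpleGraph V) (r : ℕ) :
    Set (Σ W : Set V, SimpleGraph W) :=
  {H | IsShallowTopologicalMinor G r H.2}

/-- The largest clique number of an `r`-shallow topological minor of `G`. -/
noncomputable def shallowCliqueNum {V : Type} (G : SimpleGraph V) (r : ℕ) : ℕ :=
  sSup ((fun H : Σ W : Set V, SimpleGraph W => H.2.cliqueNum) '' shallowTopologicalMinors G r)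

/-- For a finite graph the supremum in `shallowCliqueNum` is a maximum. -/
theorem isGreatest_shallowCliqueNum {V : Type} [Finite V] (G : SimpleGraph V) (r : ℕ) :
    IsGreatest ((fun H : Σ W : Set V, SimpleGraph W => H.2.cliqueNum) ''
      shallowTopologicalMinors G r) (shallowCliqueNum G r) := by
  have hfin : ((fun H : Σ W : Set V, SimpleGraph W => H.2.cliqueNum) ''
      shallowTopologicalMinors G r).Finite := by
    have : Finite (Σ W : Set V, SimpleGraph W) := inferInstance
    exact Set.toFinite _
  have hne : ((fun H : Σ W : Set V, SimpleGraph W => H.2.cliqueNum) ''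
      shallowTopologicalMinors G r).Nonempty := by
    refine ⟨_, ⟨∅, ⊥⟩, ?_, rfl⟩
    exact ⟨fun u => u.2.elim, fun u => u.2.elim, fun u => u.2.elim, fun u => u.2.elim,
      fun u => u.2.elim⟩
  exact ⟨Nat.sSup_mem hne hfin.bddAbove, fun _ hx => le_csSup hfin.bddAbove hx⟩

/-- A random graph model is asymptotically almost surely somewhere-dense. The outer measure of a
`PMF` is the probability of an event. -/
def RandomGraphModel.AasSomewhereDense (𝒢 : RandomGraphModel) : Prop :=
  ∀ f : ℕ → ℝ, ∃ r : ℕ,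
    Filter.Tendsto
      (fun n => (𝒢 n).toOuterMeasure {G | f r < (shallowCliqueNum G.toSimple r : ℝ)})
      Filter.atTop (nhds 1)

/-!
For every fixed `k`, the graph `G_m^n` contains asymptotically almost surely a complete graph on `k`
vertices in which every edge is subdivided once. Since its paths have length two, `r = 1` works for
every `f`, with any `k` larger than `f 1`.

The principal vertices are the `k` oldest ones. The degree `D` of an old vertex after `t` steps of
the process for `m = 1` satisfies `E[1 / (D - 1)] = O(1 / √t)`, since this mean changes by the exact
factor `2 t / (2 t + 1)` in each step (`mean_inv_degree_le`); this uses `m ≥ 2`, which gives `D ≥ 2`.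
Hence `D` is at least of order `√t` up to a small probability. The first two edges of the vertex `b`
of `G_m^n` lead to two given old vertices `i` and `j` with conditional probability of order
`D i * D j / t ^ 2`, which is then of order `1 / b`. As the harmonic series diverges along every
residue class, the probability that no `b` in a given residue class is adjacent to both `i` and `j`
tends to `0` (`tendsto_missProb`). This needs neither independence nor concentration: that probability
is nonincreasing, and if its limit were positive it would drop by a fixed multiple of `1 / b`
infinitely often (`missProb_succ_block_le`).

Different pairs `i < j < k` are served by different residue classes modulo `k * k`, so that the middle
vertices of different paths are distinct (`le_shallowCliqueNum`), and a union bound over the pairs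
finishes the proof.
-/

/-! ### Degrees in multigraphs -/

namespace Multigraph

lemma degree_cons {V : Type} [DecidableEq V] (a b v : V) (E : Multigraph V) :
    degree (s(a, b) ::ₘ E) v =
      ((if v = a then 1 else 0) + if v = b then 1 else 0) + E.degree v := by
  simp only [degree, Multiset.cons_bind, Multiset.count_add, Nat.add_right_cancel_iff]
  change Multiset.count v (a ::ₘ b ::ₘ 0) = _
  rw [Multiset.count_cons, Multiset.count_cons, Multiset.count_zero, zero_add, add_comm]

lemma degree_merge {V W : Type} [DecidableEq V] [DecidableEq W] [Fintype V] (p : V → W)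
    (E : Multigraph V) (w : W) :
    (E.merge p).degree w = ∑ v, if p v = w then E.degree v else 0 := by
  induction E using Multiset.induction with
  | empty => simp [merge, degree]
  | cons e E ih =>
    induction e with
    | _ a b =>
      have h : merge p (s(a, b) ::ₘ E) = s(p a, p b) ::ₘ merge p E := by simp [merge]
      have hsplit : ∀ v, (if p v = w then degree (s(a, b) ::ₘ E) v else 0) =
          ((if v = a then (if w = p a then 1 else 0) else 0) +
            (if v = b then (if w = p b then 1 else 0) else 0)) +
            (if p v = w then degree E v else 0) := by
        intro v
        rw [degree_cons]
        by_cases hv : p v = w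
        · subst hv
          by_cases h1 : v = a <;> by_cases h2 : v = b <;> simp_all
        · by_cases h1 : v = a <;> by_cases h2 : v = b <;> simp_all [eq_comm]
      rw [h, degree_cons, ih, Finset.sum_congr rfl fun v _ => hsplit v]
      simp [Finset.sum_add_distrib]

end Multigraph

namespace PreferentialAttachment

/-! ### Means over the process -/

noncomputable instance (t : ℕ) : Fintype (State t) :=
  inferInstanceAs (Fintype (Sym (Sym2 (Fin t)) t))

/-- The mean of a real function under a probability distribution on a finite type. -/
noncomputable def mean {α : Type} [Fintype α] (p : PMF α) (g : α → ℝ) : ℝ :=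
  ∑ a, (p a).toReal * g a

section mean

variable {α β : Type} [Fintype α] [Fintype β] (p : PMF α)

lemma sum_toReal_pmf : ∑ a, (p a).toReal = 1 := by
  rw [← ENNReal.toReal_sum fun a _ => p.apply_ne_top a, ← tsum_fintype (L := .unconditional α),
    p.tsum_coe]
  rfl

lemma mean_mono {f g : α → ℝ} (h : ∀ a ∈ p.support, f a ≤ g a) : mean p f ≤ mean p g := by
  refine Finset.sum_le_sum fun a _ => ?_
  by_cases ha : a ∈ p.support
  · exact mul_le_mul_of_nonneg_left (h a ha) ENNReal.toReal_nonneg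
  · simp [(p.apply_eq_zero_iff a).2 ha]

lemma mean_const (c : ℝ) : mean p (fun _ => c) = c := by
  rw [mean, ← Finset.sum_mul, sum_toReal_pmf, one_mul]

lemma mean_mul_left (c : ℝ) (f : α → ℝ) : mean p (fun a => c * f a) = c * mean p f := by
  simp only [mean, Finset.mul_sum]
  exact Finset.sum_congr rfl fun a _ => by ring

lemma mean_add (f g : α → ℝ) : mean p (fun a => f a + g a) = mean p f + mean p g := by
  simp only [mean, ← Finset.sum_add_distrib]
  exact Finset.sum_congr rfl fun a _ => by ring

lemma mean_sub (f g : α → ℝ) : mean p (fun a => f a - g a) = mean p f - mean p g := by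
  simp only [mean, ← Finset.sum_sub_distrib]
  exact Finset.sum_congr rfl fun a _ => by ring

lemma mean_sum {ι : Type} (s : Finset ι) (f : ι → α → ℝ) :
    mean p (fun a => ∑ i ∈ s, f i a) = ∑ i ∈ s, mean p (f i) := by
  simp only [mean, Finset.mul_sum]
  exact Finset.sum_comm

lemma mean_bind (q : α → PMF β) (g : β → ℝ) :
    mean (p.bind q) g = mean p fun a => mean (q a) g := by
  have h : ∀ b, ((p.bind q) b).toReal = ∑ a, (p a).toReal * (q a b).toReal := fun b => by
    rw [PMF.bind_apply, tsum_fintype, ENNReal.toReal_sum fun a _ =>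
      ENNReal.mul_ne_top (p.apply_ne_top a) ((q a).apply_ne_top b)]
    simp
  simp only [mean, h, Finset.sum_mul, Finset.mul_sum]
  rw [Finset.sum_comm]
  simp only [mul_assoc]

lemma mean_map (f : α → β) (g : β → ℝ) : mean (p.map f) g = mean p (g ∘ f) := by
  classical
  rw [← PMF.bind_pure_comp, mean_bind]
  congr 1
  ext a
  simp only [mean, Function.comp_apply, PMF.pure_apply]
  rw [Finset.sum_eq_single (f a)] <;> simp +contextual

lemma toReal_toOuterMeasure (s : Set α) :
    (p.toOuterMeasure s).toReal = mean p (s.indicator 1) := by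
  classical
  rw [PMF.toOuterMeasure_apply_fintype, ENNReal.toReal_sum]
  · refine Finset.sum_congr rfl fun a _ => ?_
    by_cases h : a ∈ s <;> simp [h]
  · intro a _
    by_cases h : a ∈ s <;> simp [h, p.apply_ne_top a]

end mean

lemma mean_process_succ (t : ℕ) (g : State (t + 1) → ℝ) :
    mean (process (t + 1)) g = mean (process t) fun E =>
      ∑ x, (attachProb E x).toReal * g (addVertex E x) := by
  rw [process, mean_bind]
  congr 1
  ext E
  rw [mean_map]
  rfl

lemma sum_toReal_attachProb {t : ℕ} (E : State t) : ∑ x, (attachProb E x).toReal = 1 :=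
  sum_toReal_pmf (PMF.ofFintype (attachProb E) (sum_attachProb E))

/-! ### Merged blocks along the process -/

/-- The multigraph obtained from a state by merging blocks of `m` consecutive vertices, with the
blocks labelled by natural numbers, so that the graphs at different times live on one vertex set. -/
def blockGraph (m : ℕ) {t : ℕ} (E : State t) : Multigraph ℕ :=
  E.1.merge fun x : Fin t => (x : ℕ) / m

lemma blockGraph_addVertex (m : ℕ) {t : ℕ} (E : State t) (x : Fin (t + 1)) :
    blockGraph m (addVertex E x) = s(t / m, (x : ℕ) / m) ::ₘ blockGraph m E := by
  simp [blockGraph, addVertex, Multigraph.merge, Sym2.map_map]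

lemma mem_blockGraph_iff {m n : ℕ} (E : State (n * m)) (u v : Fin n) :
    s((u : ℕ), (v : ℕ)) ∈ blockGraph m E ↔
      s(u, v) ∈ E.1.merge (Fin.divNat (m := n) (n := m)) := by
  have h : blockGraph m E =
      (E.1.merge (Fin.divNat (m := n) (n := m))).map (Sym2.map Fin.val) := by
    simp [blockGraph, Multigraph.merge, Function.comp_def, Sym2.map_map]
  rw [h, ← Sym2.map_mk, Multiset.mem_map_of_injective (Sym2.map.injective Fin.val_injective)]

/-- The new edge ends in the block `i`, which is already complete, with probability proportional to
the degree of the block. -/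
lemma sum_attachProb_block {m t i : ℕ} (hm : 0 < m) (hi : (i + 1) * m ≤ t) (E : State t) (a b : ℝ) :
    ∑ x, (attachProb E x).toReal * (if (x : ℕ) / m = i then a else b) =
      b - (blockGraph m E).degree i / (2 * t + 1) * (b - a) := by
  have key : ∑ x, (attachProb E x).toReal * (if (x : ℕ) / m = i then 1 else 0) =
      (blockGraph m E).degree i / (2 * t + 1) := by
    rw [Fin.sum_univ_castSucc, blockGraph, Multigraph.degree_merge]
    have hlast : ((Fin.last t : Fin (t + 1)) : ℕ) / m ≠ i := by
      have := (Nat.le_div_iff_mul_le hm).2 hi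
      simp only [Fin.val_last]
      omega
    rw [if_neg hlast, mul_zero, add_zero, Nat.cast_sum, Finset.sum_div]
    refine Finset.sum_congr rfl fun x _ => ?_
    by_cases hx : (x : ℕ) / m = i
    · simp [hx, attachProb, ENNReal.toReal_add, ENNReal.toReal_mul, ENNReal.mul_ne_top]
    · simp [hx]
  have hsplit : ∀ x : Fin (t + 1),
      (attachProb E x).toReal * (if (x : ℕ) / m = i then a else b) =
        b * (attachProb E x).toReal -
          (b - a) * ((attachProb E x).toReal * (if (x : ℕ) / m = i then 1 else 0)) := by
    intro x
    split_ifs <;> ring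
  rw [Finset.sum_congr rfl fun x _ => hsplit x, Finset.sum_sub_distrib, ← Finset.mul_sum,
    ← Finset.mul_sum, key, sum_toReal_attachProb]
  ring

/-- Each vertex of a block contributes at least one endpoint to the degree of the block. -/
lemma le_degree_blockGraph {m : ℕ} (i t : ℕ) : ∀ E ∈ (process t).support,
    min m (t - i * m) ≤ (blockGraph m E).degree i := by
  induction t with
  | zero => simp
  | succ t ih =>
    intro E' hE'
    rw [process, PMF.mem_support_bind_iff] at hE'
    obtain ⟨E, hE, hE'⟩ := hE'
    obtain ⟨x, -, rfl⟩ := (PMF.mem_support_map_iff _ _ _).1 hE'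
    have h := ih E hE
    rw [blockGraph_addVertex, Multigraph.degree_cons]
    by_cases hlt : t < i * m
    · omega
    by_cases hti : t < i * m + m
    · have : t / m = i := Nat.div_eq_of_lt_le (by omega) (by rw [Nat.succ_mul]; omega)
      rw [if_pos this.symm]
      omega
    · omega

/-! ### Growth of the degree of a block -/

lemma two_le_degree_blockGraph {m i t : ℕ} (hm : 2 ≤ m) (hi : (i + 1) * m ≤ t) {E : State t}
    (hE : E ∈ (process t).support) : (2 : ℝ) ≤ (blockGraph m E).degree i := by
  have h := le_degree_blockGraph (m := m) i t E hE
  rw [Nat.succ_mul] at hi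
  exact_mod_cast (show 2 ≤ (blockGraph m E).degree i by omega)

/-- If `D` is the degree of a complete block, then the mean of `1 / (D - 1)` is multiplied by
exactly `2 t / (2 t + 1)` when the `(t + 1)`-st vertex is added, so it decays like `1 / √t`. By Markov's
inequality, `D` is therefore of order at least `√t` with probability close to `1`. -/
lemma mean_inv_degree_le {m i t : ℕ} (hm : 2 ≤ m) (hi : (i + 1) * m ≤ t) :
    mean (process t) (fun E => 1 / (((blockGraph m E).degree i : ℝ) - 1)) * √t ≤
      √((i + 1) * m : ℕ) := by
  induction t, hi using Nat.le_induction with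
  | base =>
    refine mul_le_of_le_one_left (Real.sqrt_nonneg _) ?_
    refine (mean_mono _ fun E hE => ?_).trans_eq (mean_const (process ((i + 1) * m)) 1)
    have := two_le_degree_blockGraph hm le_rfl hE
    rw [div_le_one] <;> linarith
  | succ t hi ih =>
    have hstep : mean (process (t + 1))
        (fun E => 1 / (((blockGraph m E).degree i : ℝ) - 1)) ≤
        2 * t / (2 * t + 1) *
          mean (process t) (fun E => 1 / (((blockGraph m E).degree i : ℝ) - 1)) := by
      rw [mean_process_succ, ← mean_mul_left]
      refine mean_mono _ fun E hE => le_of_eq ?_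
      have hD := two_le_degree_blockGraph hm hi hE
      have hne : i ≠ t / m := by
        have := (Nat.le_div_iff_mul_le (by omega : 0 < m)).2 hi
        omega
      have hx : ∀ x : Fin (t + 1),
          1 / (((blockGraph m (addVertex E x)).degree i : ℝ) - 1) =
            if (x : ℕ) / m = i then 1 / ((blockGraph m E).degree i : ℝ)
            else 1 / (((blockGraph m E).degree i : ℝ) - 1) := by
        intro x
        rw [blockGraph_addVertex, Multigraph.degree_cons, if_neg hne]
        by_cases h : (x : ℕ) / m = i
        · simp [h]
        · simp [h, Ne.symm h]
      simp only [hx]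
      rw [sum_attachProb_block (by omega) hi]
      have h1 : ((blockGraph m E).degree i : ℝ) - 1 ≠ 0 := by linarith
      have h2 : ((blockGraph m E).degree i : ℝ) ≠ 0 := by linarith
      have h3 : (2 * (t : ℝ) + 1) ≠ 0 := by positivity
      field_simp
      ring
    have hsqrt : 2 * (t : ℝ) / (2 * t + 1) * √((t + 1 : ℕ) : ℝ) ≤ √t := by
      refine Real.le_sqrt_of_sq_le ?_
      rw [mul_pow, Real.sq_sqrt (by positivity), div_pow, div_mul_eq_mul_div,
        div_le_iff₀ (by positivity)]
      push_cast
      nlinarith [Nat.cast_nonneg (α := ℝ) t]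
    have h0 : 0 ≤ mean (process t)
        (fun E => 1 / (((blockGraph m E).degree i : ℝ) - 1)) := by
      rw [← mean_const (process t) 0]
      refine mean_mono _ fun E hE => ?_
      have := two_le_degree_blockGraph hm hi hE
      exact div_nonneg zero_le_one (by linarith)
    calc _ ≤ _ := mul_le_mul_of_nonneg_right hstep (Real.sqrt_nonneg _)
      _ = mean (process t) (fun E => 1 / (((blockGraph m E).degree i : ℝ) - 1)) *
          (2 * t / (2 * t + 1) * √((t + 1 : ℕ) : ℝ)) := by ring
      _ ≤ _ := mul_le_mul_of_nonneg_left hsqrt h0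
      _ ≤ _ := ih

/-! ### Common neighbours of two blocks -/

/-- Some vertex in `S` is adjacent to both `i` and `j`. -/
def Linked (S : Set ℕ) (i j : ℕ) (G : Multigraph ℕ) : Prop :=
  ∃ b ∈ S, s(b, i) ∈ G ∧ s(b, j) ∈ G

open scoped Classical in
/-- The indicator of the event that no vertex in `S` is adjacent to both `i` and `j`. -/
noncomputable def unlinked (S : Set ℕ) (i j : ℕ) (G : Multigraph ℕ) : ℝ :=
  if Linked S i j G then 0 else 1

/-- The probability that after `t` steps no block in `S` is adjacent to both `i` and `j`. -/
noncomputable def missProb (m : ℕ) (S : Set ℕ) (i j t : ℕ) : ℝ :=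
  mean (process t) fun E => unlinked S i j (blockGraph m E)

variable {m i j : ℕ} {S : Set ℕ}

lemma unlinked_nonneg (G : Multigraph ℕ) : 0 ≤ unlinked S i j G := by
  unfold unlinked; split_ifs <;> norm_num

lemma unlinked_le_one (G : Multigraph ℕ) : unlinked S i j G ≤ 1 := by
  unfold unlinked; split_ifs <;> norm_num

lemma unlinked_cons_le (e : Sym2 ℕ) (G : Multigraph ℕ) :
    unlinked S i j (e ::ₘ G) ≤ unlinked S i j G := by
  by_cases h : Linked S i j G
  · have h' : Linked S i j (e ::ₘ G) := by
      obtain ⟨b, hb, h1, h2⟩ := h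
      exact ⟨b, hb, Multiset.mem_cons_of_mem h1, Multiset.mem_cons_of_mem h2⟩
    simp [unlinked, h, h']
  · refine (unlinked_le_one _).trans ?_
    simp [unlinked, h]

lemma missProb_nonneg (t : ℕ) : 0 ≤ missProb m S i j t := by
  rw [← mean_const (process t) 0]
  exact mean_mono _ fun E _ => unlinked_nonneg _

lemma missProb_le_one (t : ℕ) : missProb m S i j t ≤ 1 := by
  rw [← mean_const (process t) 1]
  exact mean_mono _ fun E _ => unlinked_le_one _

lemma antitone_missProb : Antitone (missProb m S i j) := by
  refine antitone_nat_of_succ_le fun t => ?_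
  rw [missProb, mean_process_succ]
  refine mean_mono _ fun E _ => ?_
  calc _ ≤ ∑ x, (attachProb E x).toReal * unlinked S i j (blockGraph m E) := by
        refine Finset.sum_le_sum fun x _ => mul_le_mul_of_nonneg_left ?_ ENNReal.toReal_nonneg
        rw [blockGraph_addVertex]
        exact unlinked_cons_le _ _
    _ = _ := by rw [← Finset.sum_mul, sum_toReal_attachProb, one_mul]

lemma degree_blockGraph_le {t : ℕ} (hm : 0 < m) (hi : (i + 1) * m ≤ t) (E : State t) :
    ((blockGraph m E).degree i : ℝ) ≤ 2 * t + 1 := by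
  have h := sum_attachProb_block hm hi E 0 1
  have h0 : 0 ≤ ∑ x, (attachProb E x).toReal * (if (x : ℕ) / m = i then (0 : ℝ) else 1) :=
    Finset.sum_nonneg fun x _ => mul_nonneg ENNReal.toReal_nonneg (by split_ifs <;> norm_num)
  rw [h, sub_zero, mul_one, sub_nonneg, div_le_one (by positivity)] at h0
  exact h0

/-- If the new vertex belongs to a block `b ∈ S` that is already adjacent to `i`, then the blocks
`i` and `j` become linked as soon as the new edge leads to `j`. -/
lemma sum_attachProb_unlinked_le {t b : ℕ} (hm : 0 < m) (hb : b ∈ S) (hj : (j + 1) * m ≤ t)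
    (ht : t / m = b) (E : State t) (hE : s(b, i) ∈ blockGraph m E) :
    ∑ x, (attachProb E x).toReal * unlinked S i j (blockGraph m (addVertex E x)) ≤
      unlinked S i j (blockGraph m E) *
        (1 - (blockGraph m E).degree j / (2 * t + 1)) := by
  have h := sum_attachProb_block hm hj E 0 1
  rw [sub_zero, mul_one] at h
  rw [← h, Finset.mul_sum]
  refine Finset.sum_le_sum fun x _ => ?_
  rw [mul_left_comm]
  refine mul_le_mul_of_nonneg_left ?_ ENNReal.toReal_nonneg
  rw [blockGraph_addVertex, ht]
  split_ifs with hx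
  · have : Linked S i j (s(b, (x : ℕ) / m) ::ₘ blockGraph m E) :=
      ⟨b, hb, Multiset.mem_cons_of_mem hE, by rw [hx]; exact Multiset.mem_cons_self _ _⟩
    simp [unlinked, this]
  · rw [mul_one]
    exact unlinked_cons_le _ _

/-- The first two edges of a new block `b ∈ S` lead to `i` and `j` with conditional probability at
least `D i * D j / ((2 t + 1) * (2 t + 3))`, where `D` denotes the degrees before their insertion
and `t = b * m`. -/
lemma missProb_add_two_le {b : ℕ} (hm : 2 ≤ m) (hb : b ∈ S) (hib : i < b) (hjb : j < b) :
    missProb m S i j (b * m + 2) ≤ mean (process (b * m)) fun E =>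
      unlinked S i j (blockGraph m E) -
        1 / ((2 * (b * m : ℕ) + 1) * (2 * (b * m : ℕ) + 3)) *
          (unlinked S i j (blockGraph m E) *
            ((blockGraph m E).degree i * (blockGraph m E).degree j)) := by
  have hm0 : 0 < m := by omega
  have hi : (i + 1) * m ≤ b * m := Nat.mul_le_mul_right _ hib
  have hj : (j + 1) * m ≤ b * m := Nat.mul_le_mul_right _ hjb
  have hb0 : b * m / m = b := Nat.mul_div_cancel _ hm0
  have hb1 : (b * m + 1) / m = b := by
    rw [mul_comm, Nat.mul_add_div hm0, Nat.div_eq_of_lt (by omega), add_zero]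
  set t := b * m with ht
  rw [missProb, mean_process_succ, mean_process_succ]
  refine mean_mono _ fun E _ => ?_
  set U := unlinked S i j (blockGraph m E)
  set Di := ((blockGraph m E).degree i : ℝ)
  set Dj := ((blockGraph m E).degree j : ℝ)
  have hU : 0 ≤ U := unlinked_nonneg _
  have hDj : Dj ≤ 2 * t + 1 := degree_blockGraph_le hm0 hj E
  have hfac : 0 ≤ 1 - Dj / (2 * t + 3) := by
    rw [sub_nonneg, div_le_one (by positivity)]
    linarith
  calc _ ≤ ∑ x, (attachProb E x).toReal *
        (U * if (x : ℕ) / m = i then 1 - Dj / (2 * t + 3) else 1) := by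
        refine Finset.sum_le_sum fun x _ => mul_le_mul_of_nonneg_left ?_ ENNReal.toReal_nonneg
        have hE' : blockGraph m (addVertex E x) = s(b, (x : ℕ) / m) ::ₘ blockGraph m E := by
          rw [blockGraph_addVertex, hb0]
        have hUE : unlinked S i j (blockGraph m (addVertex E x)) ≤ U := by
          rw [hE']
          exact unlinked_cons_le _ _
        split_ifs with hx
        · refine (sum_attachProb_unlinked_le hm0 hb (by omega) hb1 _ ?_).trans ?_
          · rw [hE', hx]
            exact Multiset.mem_cons_self _ _
          · have hD : Dj ≤ ((blockGraph m (addVertex E x)).degree j : ℝ) := by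
              rw [hE', Multigraph.degree_cons]
              exact Nat.cast_le.2 (Nat.le_add_left _ _)
            have hle : 1 - ((blockGraph m (addVertex E x)).degree j : ℝ) /
                (2 * ((t + 1 : ℕ) : ℝ) + 1) ≤ 1 - Dj / (2 * t + 3) := by
              have : 2 * ((t + 1 : ℕ) : ℝ) + 1 = 2 * t + 3 := by push_cast; ring
              rw [this]
              gcongr
            exact (mul_le_mul_of_nonneg_left hle (unlinked_nonneg _)).trans
              (mul_le_mul_of_nonneg_right hUE hfac)
        · rw [mul_one]
          refine le_trans ?_ hUE
          rw [← one_mul (unlinked S i j (blockGraph m (addVertex E x))),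
            ← sum_toReal_attachProb (addVertex E x), Finset.sum_mul]
          refine Finset.sum_le_sum fun y _ => mul_le_mul_of_nonneg_left ?_ ENNReal.toReal_nonneg
          rw [blockGraph_addVertex]
          exact unlinked_cons_le _ _
    _ = U * ∑ x, (attachProb E x).toReal *
        (if (x : ℕ) / m = i then 1 - Dj / (2 * t + 3) else 1) := by
        rw [Finset.mul_sum]
        exact Finset.sum_congr rfl fun x _ => mul_left_comm _ _ _
    _ = _ := by
        rw [sum_attachProb_block hm0 hi]
        field_simp
        ring

/-- The pointwise form of Markov's inequality that turns the lower tail of the degrees into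
`mean_inv_degree_le`: the right-hand side is nonpositive unless both degrees exceed `a`. -/
lemma le_mul_degrees {U a x y : ℝ} (hU0 : 0 ≤ U) (hU1 : U ≤ 1) (ha : 0 ≤ a) (hx : 2 ≤ x)
    (hy : 2 ≤ y) : a ^ 2 * (U - a * (1 / (x - 1)) - a * (1 / (y - 1))) ≤ U * (x * y) := by
  have hx' : 0 ≤ a * (1 / (x - 1)) := mul_nonneg ha (one_div_nonneg.2 (by linarith))
  have hy' : 0 ≤ a * (1 / (y - 1)) := mul_nonneg ha (one_div_nonneg.2 (by linarith))
  have hR : 0 ≤ U * (x * y) := by positivity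
  by_cases hax : x - 1 ≤ a
  · have : 1 ≤ a * (1 / (x - 1)) := by
      rw [mul_one_div, le_div_iff₀ (by linarith)]
      linarith
    exact (mul_nonpos_of_nonneg_of_nonpos (sq_nonneg a) (by linarith)).trans hR
  by_cases hay : y - 1 ≤ a
  · have : 1 ≤ a * (1 / (y - 1)) := by
      rw [mul_one_div, le_div_iff₀ (by linarith)]
      linarith
    exact (mul_nonpos_of_nonneg_of_nonpos (sq_nonneg a) (by linarith)).trans hR
  calc _ ≤ a ^ 2 * U := mul_le_mul_of_nonneg_left (by linarith) (sq_nonneg a)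
    _ = U * (a * a) := by ring
    _ ≤ _ := by
      refine mul_le_mul_of_nonneg_left ?_ hU0
      exact mul_le_mul (by linarith) (by linarith) ha (by linarith)

/-- While a new block `b ∈ S` is inserted, the probability that `i` and `j` are not linked drops by
a fixed multiple of `1 / b`, as long as it is not small compared to `ε`. -/
lemma missProb_succ_block_le {b k : ℕ} (hm : 2 ≤ m) (hb : b ∈ S) (hik : i < k) (hjk : j < k)
    (hkb : k ≤ b) {ε : ℝ} (hε : 0 ≤ ε) :
    missProb m S i j ((b + 1) * m) ≤ missProb m S i j (b * m) -
      ε ^ 2 * (b * m : ℕ) / ((2 * (b * m : ℕ) + 1) * (2 * (b * m : ℕ) + 3)) *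
        (missProb m S i j (b * m) - 2 * ε * √(k * m : ℕ)) := by
  have hle : b * m + 2 ≤ (b + 1) * m := by rw [Nat.succ_mul]; omega
  refine (antitone_missProb hle).trans
    ((missProb_add_two_le hm hb (hik.trans_le hkb) (hjk.trans_le hkb)).trans ?_)
  rw [mean_sub, mean_mul_left]
  change missProb m S i j (b * m) - _ ≤ _
  have hi : (i + 1) * m ≤ b * m := Nat.mul_le_mul_right _ (hik.trans_le hkb)
  have hj : (j + 1) * m ≤ b * m := Nat.mul_le_mul_right _ (hjk.trans_le hkb)
  have hsi : √((i + 1) * m : ℕ) ≤ √(k * m : ℕ) :=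
    Real.sqrt_le_sqrt (by exact_mod_cast Nat.mul_le_mul_right _ hik)
  have hsj : √((j + 1) * m : ℕ) ≤ √(k * m : ℕ) :=
    Real.sqrt_le_sqrt (by exact_mod_cast Nat.mul_le_mul_right _ hjk)
  have hMi := (mean_inv_degree_le hm hi).trans hsi
  have hMj := (mean_inv_degree_le hm hj).trans hsj
  set t := b * m
  set a := ε * √t with ha
  have ha0 : 0 ≤ a := by positivity
  have hmean := mean_mono (process t) fun E hE => le_mul_degrees
    (unlinked_nonneg (S := S) (i := i) (j := j) (blockGraph m E)) (unlinked_le_one _) ha0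
    (two_le_degree_blockGraph hm hi hE) (two_le_degree_blockGraph hm hj hE)
  rw [mean_mul_left, mean_sub, mean_sub, mean_mul_left, mean_mul_left] at hmean
  change a ^ 2 * (missProb m S i j t - _ - _) ≤ _ at hmean
  have ha2 : a ^ 2 = ε ^ 2 * t := by rw [ha, mul_pow, Real.sq_sqrt (by positivity)]
  have hlow : ε ^ 2 * t * (missProb m S i j t - 2 * ε * √(k * m : ℕ)) ≤
      mean (process t) fun E => unlinked S i j (blockGraph m E) *
        ((blockGraph m E).degree i * (blockGraph m E).degree j) := by
    refine le_trans ?_ hmean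
    rw [ha2]
    refine mul_le_mul_of_nonneg_left ?_ (by positivity)
    have h1 := mul_le_mul_of_nonneg_left hMi hε
    have h2 := mul_le_mul_of_nonneg_left hMj hε
    rw [ha]
    linarith
  refine sub_le_sub_left ?_ _
  calc _ = 1 / ((2 * (t : ℝ) + 1) * (2 * t + 3)) *
        (ε ^ 2 * t * (missProb m S i j t - 2 * ε * √(k * m : ℕ))) := by ring
    _ ≤ _ := mul_le_mul_of_nonneg_left hlow (by positivity)

open Filter Topology in
/-- The drops of `missProb` at the blocks of `S` would add up to infinity if its limit were
positive. -/
lemma tendsto_missProb {k : ℕ} (hm : 2 ≤ m) (hik : i < k) (hjk : j < k) (hSk : ∀ b ∈ S, k ≤ b)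
    (hS : ¬ Summable (S.indicator fun n : ℕ => (1 / n : ℝ))) :
    Tendsto (fun n => missProb m S i j (n * m)) atTop (𝓝 0) := by
  set q : ℕ → ℝ := fun n => missProb m S i j (n * m) with hq
  have hanti : Antitone q := fun n n' h => antitone_missProb (Nat.mul_le_mul_right _ h)
  have hbdd : BddBelow (Set.range q) := ⟨0, by rintro _ ⟨n, rfl⟩; exact missProb_nonneg _⟩
  have hlim := tendsto_atTop_ciInf hanti hbdd
  set L := ⨅ n, q n
  have hL0 : 0 ≤ L := le_ciInf fun n => missProb_nonneg _
  rcases hL0.eq_or_lt with hL | hL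
  · rwa [← hL] at hlim
  exfalso
  apply hS
  have hkm : 0 < √(k * m : ℕ) :=
    Real.sqrt_pos.2 (by exact_mod_cast Nat.mul_pos (by omega) (by omega))
  -- this choice makes `2 ε √(k m)` equal to half of the limit
  set ε := L / (4 * √(k * m : ℕ)) with hε
  have hε0 : 0 < ε := by positivity
  have hεL : 2 * ε * √(k * m : ℕ) = L / 2 := by rw [hε]; field_simp; norm_num
  have hm0 : (0 : ℝ) < m := by exact_mod_cast (by omega : 0 < m)
  set δ := ε ^ 2 / (15 * m) * (L / 2) with hδ
  have hδ0 : 0 < δ := by positivity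
  have hdrop : ∀ n, S.indicator (fun n : ℕ => (1 / n : ℝ)) n ≤ δ⁻¹ * (q n - q (n + 1)) := by
    intro n
    rw [inv_mul_eq_div, le_div_iff₀ hδ0]
    by_cases hn : n ∈ S
    · have h := missProb_succ_block_le hm hn hik hjk (hSk n hn) hε0.le
      have hn1 : 1 ≤ n := by have := hSk n hn; omega
      have ht : (1 : ℝ) ≤ (n * m : ℕ) := by
        exact_mod_cast Nat.mul_pos hn1 (by omega : 0 < m)
      have hqL : L ≤ q n := ciInf_le hbdd n
      rw [hεL] at h
      change q (n + 1) ≤ q n - _ * (q n - _) at h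
      have hcoef : ε ^ 2 / (15 * m) * (1 / n) ≤
          ε ^ 2 * (n * m : ℕ) / ((2 * (n * m : ℕ) + 1) * (2 * (n * m : ℕ) + 3)) := by
        have hrw : ε ^ 2 / (15 * m) * (1 / n) = ε ^ 2 / (15 * (n * m : ℕ)) := by
          push_cast
          field_simp
        rw [hrw, div_le_div_iff₀ (by positivity) (by positivity), mul_assoc]
        refine mul_le_mul_of_nonneg_left ?_ (sq_nonneg ε)
        nlinarith
      have hmul := mul_le_mul hcoef (show L / 2 ≤ q n - L / 2 by linarith) (by linarith)
        (by positivity)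
      rw [Set.indicator_of_mem hn, hδ]
      linarith
    · rw [Set.indicator_of_notMem hn, zero_mul, sub_nonneg]
      exact hanti n.le_succ
  refine summable_of_sum_range_le (c := δ⁻¹)
    (fun n => Set.indicator_nonneg (fun n _ => by positivity) n)
    fun n => ?_
  calc _ ≤ ∑ l ∈ Finset.range n, δ⁻¹ * (q l - q (l + 1)) := Finset.sum_le_sum fun l _ => hdrop l
    _ = δ⁻¹ * (q 0 - q n) := by rw [← Finset.mul_sum, Finset.sum_range_sub']
    _ ≤ δ⁻¹ * 1 := by
      refine mul_le_mul_of_nonneg_left ?_ (by positivity)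
      have h0 : q 0 ≤ 1 := missProb_le_one _
      have hn : 0 ≤ q n := missProb_nonneg _
      linarith
    _ = δ⁻¹ := mul_one _

end PreferentialAttachment

/-! ### Subdivided cliques -/

/-- Connecting each pair of vertices of `W` by a path of length two, with middle vertices that are
outside `W` and different for different pairs, makes the complete graph on `W` a shallow topological
minor. -/
lemma isShallowTopologicalMinor_top {V : Type} (G : SimpleGraph V) (W : Set V) (c : V → V → V)
    (hsymm : ∀ u v, c u v = c v u)
    (hadj : ∀ u ∈ W, ∀ v ∈ W, u ≠ v → G.Adj u (c u v))
    (hout : ∀ u ∈ W, ∀ v ∈ W, u ≠ v → c u v ∉ W)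
    (hinj : ∀ u ∈ W, ∀ v ∈ W, u ≠ v → ∀ u' ∈ W, ∀ v' ∈ W, u' ≠ v' →
      c u v = c u' v' → s(u, v) = s(u', v')) :
    IsShallowTopologicalMinor G 1 (⊤ : SimpleGraph W) := by
  have hne : ∀ {u v : W}, (⊤ : SimpleGraph W).Adj u v → (u : V) ≠ v := fun h =>
    Subtype.coe_injective.ne h
  have h1 : ∀ {u v : W}, (⊤ : SimpleGraph W).Adj u v → G.Adj u (c u v) := fun {u v} h =>
    hadj u u.2 v v.2 (hne h)
  have h2 : ∀ {u v : W}, (⊤ : SimpleGraph W).Adj u v → G.Adj (c u v) v := fun {u v} h => by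
    rw [hsymm]
    exact (h1 h.symm).symm
  refine ⟨fun u v h => .cons (h1 h) (.cons (h2 h) .nil), fun u v h => ⟨?_, by simp⟩,
    fun u v h => ?_, fun u v h x hx hxW => ?_, fun u v h u' v' h' hs x hx hx' => ?_⟩
  · simp [SimpleGraph.Walk.cons_isPath_iff, (h1 h).ne, (h2 h).ne, hne h]
  · -- `c u v` and `c v u` agree only propositionally, so the walks are compared for equal `x`, `y`
    have key : ∀ (a b x y : V) (e : x = y) (g1 : G.Adj a x) (g2 : G.Adj x b) (g3 : G.Adj b y)
        (g4 : G.Adj y a), (.cons g3 (.cons g4 .nil) : G.Walk b a) =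
          (SimpleGraph.Walk.cons g1 (.cons g2 .nil) : G.Walk a b).reverse := by
      rintro a b x y rfl g1 g2 g3 g4
      simp
    exact key _ _ _ _ (hsymm _ _) _ _ _ _
  · simp only [SimpleGraph.Walk.support_cons, SimpleGraph.Walk.support_nil, List.mem_cons,
      List.not_mem_nil, or_false] at hx
    rcases hx with rfl | rfl | rfl
    · exact .inl rfl
    · exact absurd hxW (hout u u.2 v v.2 (hne h))
    · exact .inr rfl
  · simp only [SimpleGraph.Walk.support_cons, SimpleGraph.Walk.support_nil, List.mem_cons,
      List.not_mem_nil, or_false] at hx hx'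
    by_contra hxW
    have e : x = c u v := by
      rcases hx with rfl | rfl | rfl
      · exact absurd u.2 hxW
      · rfl
      · exact absurd v.2 hxW
    have e' : x = c u' v' := by
      rcases hx' with rfl | rfl | rfl
      · exact absurd u'.2 hxW
      · rfl
      · exact absurd v'.2 hxW
    have := hinj u u.2 v v.2 (hne h) u' u'.2 v' v'.2 (hne h') (e.symm.trans e')
    apply hs
    apply Sym2.map.injective Subtype.coe_injective
    simpa using this

lemma ncard_le_shallowCliqueNum {V : Type} [Finite V] {G : SimpleGraph V} {r : ℕ} {W : Set V}
    (h : IsShallowTopologicalMinor G r (⊤ : SimpleGraph W)) :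
    W.ncard ≤ shallowCliqueNum G r := by
  have := Fintype.ofFinite W
  refine le_trans ?_ ((isGreatest_shallowCliqueNum G r).2 ⟨⟨W, ⊤⟩, h, rfl⟩)
  have hc : (⊤ : SimpleGraph W).IsClique (Finset.univ : Finset W) := fun a _ b _ hab => hab
  refine le_trans (le_of_eq ?_) hc.card_le_cliqueNum
  rw [Finset.card_univ, ← Nat.card_eq_fintype_card, Nat.card_coe_set_eq]

/-! ### Blocks reserved for a pair -/

/-- The blocks reserved for linking `i` and `j`: those of index at least `k` in the residue class
of `i * k + j` modulo `k * k`. Different pairs `i, j < k` have disjoint sets of reserved blocks. -/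
def reserved (k i j : ℕ) : Set ℕ := {b | k ≤ b ∧ b % (k * k) = i * k + j}

lemma eq_of_mem_reserved {k i j i' j' b : ℕ} (hj : j < k) (hj' : j' < k)
    (h : b ∈ reserved k i j) (h' : b ∈ reserved k i' j') : i = i' ∧ j = j' := by
  have e : i * k + j = i' * k + j' := h.2.symm.trans h'.2
  have hk : 0 < k := by omega
  constructor
  · have := congrArg (· / k) e
    simpa [mul_comm _ k, Nat.mul_add_div hk, Nat.div_eq_of_lt hj, Nat.div_eq_of_lt hj'] using this
  · have := congrArg (· % k) e
    simpa [mul_comm _ k, Nat.mul_add_mod, Nat.mod_eq_of_lt hj, Nat.mod_eq_of_lt hj'] using this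

lemma not_summable_reserved {k i j : ℕ} (hi : i < k) (hj : j < k) :
    ¬ Summable ((reserved k i j).indicator fun n : ℕ => (1 / n : ℝ)) := by
  have hlt : i * k + j < k * k := by nlinarith
  intro h
  refine Real.not_summable_indicator_one_div_natCast (m := k * k) (by omega)
    ((i * k + j : ℕ) : ZMod (k * k)) (h.congr_cofinite ?_)
  rw [Nat.cofinite_eq_atTop]
  filter_upwards [Filter.eventually_ge_atTop k] with n hn
  have : n ∈ reserved k i j ↔
      n ∈ {n : ℕ | (n : ZMod (k * k)) = ((i * k + j : ℕ) : ZMod (k * k))} := by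
    rw [Set.mem_ofPred_eq, ZMod.natCast_eq_natCast_iff', Nat.mod_eq_of_lt hlt]
    exact ⟨fun h => h.2, fun h => ⟨hn, h⟩⟩
  by_cases hmem : n ∈ reserved k i j
  · rw [Set.indicator_of_mem hmem, Set.indicator_of_mem (this.1 hmem)]
  · rw [Set.indicator_of_notMem hmem, Set.indicator_of_notMem fun h => hmem (this.2 h)]

namespace PreferentialAttachment

/-- If every two of the first `k` blocks are linked by a block that is reserved for them, then these
blocks are the principal vertices of a complete `1`-shallow topological minor. -/
lemma le_shallowCliqueNum {m n k : ℕ} (hkn : k ≤ n) (E : State (n * m))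
    (h : ∀ i < k, ∀ j < k, i < j → Linked (reserved k i j) i j (blockGraph m E)) :
    k ≤ shallowCliqueNum
      (Multigraph.toSimple (E.1.merge (Fin.divNat (m := n) (n := m)))) 1 := by
  set G := Multigraph.toSimple (E.1.merge (Fin.divNat (m := n) (n := m)))
  have hlt : ∀ b u, s(b, u) ∈ blockGraph m E → b < n := by
    intro b u hb
    obtain ⟨e, -, he⟩ := Multiset.mem_map.1 hb
    have : b ∈ Sym2.map (fun x : Fin (n * m) => (x : ℕ) / m) e := he ▸ Sym2.mem_mk_left b u
    obtain ⟨x, -, rfl⟩ := Sym2.mem_map.1 this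
    exact Nat.div_lt_of_lt_mul (x.2.trans_eq (mul_comm n m))
  have hex : ∀ u v : Fin n, ∃ b : Fin n, u < v → (v : ℕ) < k →
      (b : ℕ) ∈ reserved k u v ∧ G.Adj u b ∧ G.Adj v b := by
    intro u v
    by_cases huv : u < v ∧ (v : ℕ) < k
    · obtain ⟨b, hb, hu, hv⟩ := h u (huv.2.trans' huv.1) v huv.2 huv.1
      refine ⟨⟨b, hlt b u hu⟩, fun _ _ => ⟨hb, ?_, ?_⟩⟩
      · refine SimpleGraph.Adj.symm ((SimpleGraph.fromEdgeSet_adj _).2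
          ⟨(mem_blockGraph_iff E ⟨b, hlt b u hu⟩ u).1 hu, fun e => ?_⟩)
        have := congrArg Fin.val e
        have := hb.1
        have := huv.1
        simp only [Fin.lt_def] at *
        omega
      · refine SimpleGraph.Adj.symm ((SimpleGraph.fromEdgeSet_adj _).2
          ⟨(mem_blockGraph_iff E ⟨b, hlt b u hu⟩ v).1 hv, fun e => ?_⟩)
        have := congrArg Fin.val e
        have := hb.1
        simp only at *
        omega
    · exact ⟨u, fun h1 h2 => absurd ⟨h1, h2⟩ huv⟩
  choose c hc using hex
  have hc' : ∀ u v : Fin n, (u : ℕ) < k → (v : ℕ) < k → u ≠ v →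
      (c (min u v) (max u v) : ℕ) ∈ reserved k (min u v : Fin n) (max u v : Fin n) ∧
        G.Adj u (c (min u v) (max u v)) := by
    intro u v hu hv huv
    rcases huv.lt_or_gt with h | h
    · rw [min_eq_left h.le, max_eq_right h.le]
      exact ⟨(hc u v h hv).1, (hc u v h hv).2.1⟩
    · rw [min_eq_right h.le, max_eq_left h.le]
      exact ⟨(hc v u h hu).1, (hc v u h hu).2.2⟩
  have hmax : ∀ u v : Fin n, (u : ℕ) < k → (v : ℕ) < k → ((max u v : Fin n) : ℕ) < k := by
    intro u v hu hv
    rcases max_choice u v with e | e <;> rwa [e]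
  have hminor := isShallowTopologicalMinor_top G {v : Fin n | (v : ℕ) < k}
    (fun u v => c (min u v) (max u v)) (fun u v => by rw [min_comm, max_comm])
    (fun u hu v hv huv => (hc' u v hu hv huv).2)
    (fun u hu v hv huv hmem => absurd (hc' u v hu hv huv).1.1 (not_le.2 hmem))
    (fun u hu v hv huv u' hu' v' hv' huv' e => by
      have h1 := (hc' u v hu hv huv).1
      have h2 := (hc' u' v' hu' hv' huv').1
      rw [← e] at h2
      have := eq_of_mem_reserved (hmax u v hu hv) (hmax u' v' hu' hv') h1 h2
      have e1 : min u v = min u' v' := Fin.ext this.1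
      have e2 : max u v = max u' v' := Fin.ext this.2
      have hs : ∀ a b : Fin n, s(a, b) = s(min a b, max a b) := by
        intro a b
        rcases le_total a b with h | h
        · rw [min_eq_left h, max_eq_right h]
        · rw [min_eq_right h, max_eq_left h, Sym2.eq_swap]
      rw [hs u v, hs u' v', e1, e2])
  refine le_trans (le_of_eq ?_) (ncard_le_shallowCliqueNum hminor)
  have himg : {v : Fin n | (v : ℕ) < k} = Set.range (Fin.castLE hkn) := by
    rw [Fin.range_castLE]
  rw [himg, ← Set.image_univ, Set.ncard_image_of_injective _ (Fin.castLE_injective hkn),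
    Set.ncard_univ, Nat.card_eq_fintype_card, Fintype.card_fin]

/-- The union bound over all pairs of principal vertices. -/
lemma one_sub_sum_missProb_le {m n k : ℕ} (hkn : k ≤ n) {A : Set (Multigraph (Fin n))}
    (hA : ∀ G : Multigraph (Fin n), k ≤ shallowCliqueNum G.toSimple 1 → G ∈ A) :
    1 - ∑ i ∈ Finset.range k, ∑ j ∈ Finset.range k, missProb m (reserved k i j) i j (n * m) ≤
      ((model m n).toOuterMeasure A).toReal := by
  rw [model, PMF.toOuterMeasure_map_apply, toReal_toOuterMeasure]
  simp only [missProb]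
  rw [Finset.sum_congr rfl fun i _ => (mean_sum _ _ _).symm, ← mean_sum, sub_le_iff_le_add,
    ← mean_add]
  rw [← mean_const (process (n * m)) 1]
  refine mean_mono _ fun E _ => ?_
  have hnn : ∀ i ∈ Finset.range k,
      0 ≤ ∑ j ∈ Finset.range k, unlinked (reserved k i j) i j (blockGraph m E) :=
    fun i _ => Finset.sum_nonneg fun j _ => unlinked_nonneg _
  by_cases h : ∀ i < k, ∀ j < k, i < j → Linked (reserved k i j) i j (blockGraph m E)
  · have hmem : E ∈ (fun E : State (n * m) => E.1.merge (Fin.divNat (m := n) (n := m))) ⁻¹' A :=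
      hA _ (le_shallowCliqueNum hkn E h)
    rw [Set.indicator_of_mem hmem]
    exact le_add_of_nonneg_right (Finset.sum_nonneg hnn)
  · push Not at h
    obtain ⟨i, hi, j, hj, -, hij⟩ := h
    have h1 : (1 : ℝ) = unlinked (reserved k i j) i j (blockGraph m E) := by simp [unlinked, hij]
    have h2 := Finset.single_le_sum hnn (Finset.mem_range.2 hi)
    have h3 := Finset.single_le_sum
      (f := fun j => unlinked (reserved k i j) i j (blockGraph m E))
      (fun j _ => unlinked_nonneg _) (Finset.mem_range.2 hj)
    have h4 : 0 ≤ ((fun E : State (n * m) => E.1.merge (Fin.divNat (m := n) (n := m))) ⁻¹'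
      A).indicator (1 : State (n * m) → ℝ) E := Set.indicator_nonneg (fun _ _ => zero_le_one) E
    linarith

end PreferentialAttachment

open Filter Topology PreferentialAttachment in
theorem mainTheorem2 (m : ℕ) (hm : 2 ≤ m) :
    (PreferentialAttachment.model m).AasSomewhereDense := by
  intro f
  obtain ⟨k, hk⟩ := exists_nat_gt (f 1)
  refine ⟨1, ?_⟩
  have hle : ∀ n, (model m n).toOuterMeasure
      {G | f 1 < (shallowCliqueNum G.toSimple 1 : ℝ)} ≤ 1 := fun n => by
    rw [PMF.toOuterMeasure_apply, ← (model m n).tsum_coe]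
    exact ENNReal.tsum_le_tsum fun G => Set.indicator_le_self _ _ G
  rw [← ENNReal.tendsto_toReal_iff (fun n => ne_top_of_le_ne_top ENNReal.one_ne_top (hle n))
    ENNReal.one_ne_top, ENNReal.toReal_one]
  have hsum : Tendsto (fun n => 1 - ∑ i ∈ Finset.range k, ∑ j ∈ Finset.range k,
      missProb m (reserved k i j) i j (n * m)) atTop (𝓝 1) := by
    have h0 : Tendsto (fun n => ∑ i ∈ Finset.range k, ∑ j ∈ Finset.range k,
        missProb m (reserved k i j) i j (n * m)) atTop
        (𝓝 (∑ i ∈ Finset.range k, ∑ j ∈ Finset.range k, (0 : ℝ))) :=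
      tendsto_finsetSum _ fun i hi => tendsto_finsetSum _ fun j hj =>
        tendsto_missProb hm (Finset.mem_range.1 hi) (Finset.mem_range.1 hj) (fun b hb => hb.1)
          (not_summable_reserved (Finset.mem_range.1 hi) (Finset.mem_range.1 hj))
    simpa using h0.const_sub 1
  refine tendsto_of_tendsto_of_tendsto_of_le_of_le' hsum tendsto_const_nhds ?_
    (.of_forall fun n => ENNReal.toReal_le_of_le_ofReal zero_le_one (by simpa using hle n))
  filter_upwards [eventually_ge_atTop k] with n hn
  exact one_sub_sum_missProb_le hn fun G hG => hk.trans_le (by exact_mod_cast hG)
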